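/- Let $(X,d)$ be a finite metric space. A map $\varrho : X \to \mathbb R^N$ into a Euclidean space has distortion $D \ge 0$ if $d(x,y) \le \|\varrho(x)-\varrho(y)\| \le D\, d(x,y)$ for all $x,y \in X$; the least distortion $c_2(X,d)$ is the smallest $D$ for which a map with distortion $D$ into some $\mathbb R^N$ exists. For a connected finite graph $G$ write $c_2(G)$ for the least distortion of its vertex set with the shortest path metric. In each of the following cases the minimum is attained and has the stated value. (a) Let $q \ge 2$ and $n \ge 0$, and let $H(q,n)$ be the Hamming graph: its vertices are the vectors in $X^n$ with $|X| = q$, two of them adjacent iff they differ in exactly one coordinate. Then $c_2(H(q,n)) = \sqrt n$. (b) Let $n \ge 0$ and $v \ge 2n$, and let $J(v,n)$ be the Johnson graph: its vertices are the $n$-element subsets of a $v$-element set, two of them adjacent iff their intersection has $n-1$ elements. Then $c_2(J(v,n)) = \sqrt n$. (c) Let $G$ be a strongly regular graph of diameter $2$ with parameters $(\nu,k,\lambda,\mu)$, i.e. $G$ has $\nu$ vertices, each of degree $k$, any two adjacent vertices have exactly $\lambda$ common neighbours and any two distinct nonadjacent vertices have exactly $\mu$ common neighbours. Let $$r = \tfrac12\Big(\lambda-\mu+\sqrt{(\lambda-\mu)^2+4(k-\mu)}\Big).$$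 Then $r$ is the largest eigenvalue different from $k$ of the adjacency matrix of $G$, and $$c_2(G) = \sqrt{\frac{4(\nu-k-1)(k-r)}{k(\nu-k+r)}}.$$ -/

import Mathlib

/-- A map `ρ : X → ℝ^N` into Euclidean space has distortion `D ≥ 0` with respect to the metric `d`
if `d x y ≤ ‖ρ x - ρ y‖ ≤ D * d x y` for all `x, y`. -/
def HasDistortion {X : Type*} (d : X → X → ℝ) {N : ℕ} (ρ : X → EuclideanSpace ℝ (Fin N))
    (D : ℝ) : Prop :=
  0 ≤ D ∧ ∀ x y : X, d x y ≤ ‖ρ x - ρ y‖ ∧ ‖ρ x - ρ y‖ ≤ D * d x y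

/-- The set of all `D` such that `(X, d)` can be embedded into some Euclidean space `ℝ^N` with
distortion `D`. -/
def distortionSet {X : Type*} (d : X → X → ℝ) : Set ℝ :=
  {D | ∃ (N : ℕ) (ρ : X → EuclideanSpace ℝ (Fin N)), HasDistortion d ρ D}

/-- The shortest path metric of a (connected) graph, with real values. -/
noncomputable def pathMetric {V : Type*} (G : SimpleGraph V) (x y : V) : ℝ := (G.dist x y : ℝ)

/-- `c` is the least distortion `c₂(G)` of the connected graph `G`: some embedding has
distortion `c`, and none has a smaller distortion. -/
def IsLeastDistortion {V : Type*} (G : SimpleGraph V) (c : ℝ) : Prop :=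
  IsLeast (distortionSet (pathMetric G)) c

/-- The Hamming graph on `X^n`: two vectors are adjacent iff they differ in exactly one
coordinate. -/
def hammingGraph (X : Type*) [DecidableEq X] (n : ℕ) : SimpleGraph (Fin n → X) where
  Adj x y := (Finset.univ.filter fun i => x i ≠ y i).card = 1
  symm := ⟨fun x y h => by simpa only [ne_comm] using h⟩
  loopless := ⟨fun x h => by simp at h⟩

/-- The Johnson graph on the `n`-element subsets of `V`: two of them are adjacent iff their
intersection has `n - 1` elements. -/
def johnsonGraph (V : Type*) [DecidableEq V] (n : ℕ) :
    SimpleGraph {s : Finset V // s.card = n} where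
  Adj x y := (x.1 ∩ y.1).card + 1 = n
  symm := ⟨fun x y h => by rwa [Finset.inter_comm]⟩
  loopless := ⟨fun x h => by simp [x.2] at h⟩

/-! (a), (b): In both graphs √d embeds in Euclidean space up to scale, by indicator vectors. As d is
an integer in [0, n], d² ≤ n d ≤ n d², so a rescaling has distortion √n (`sqrt_mem_distortionSet`).
Conversely both graphs contain an isometric n-cube. By Enflo's inequality its 2^n squared diagonals,
each at least n², sum to at most its n 2^n squared edges, each at most D² (`sqrt_le_of_cube`).

(c): Let s be the other root of the quadratic of r, so (A - rI)(A - sI) = μJ. The matrix Q = cJ - (A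
- rI), c = (k - r)/ν, is (r - s) times the projection onto the s-eigenspace, hence positive
semidefinite with zero row sums. So ∑ Q x y ‖ρ x - ρ y‖² ≤ 0. The entries of Q are c - 1 ≤ 0 on
edges (squared length at most D²) and c > 0 on non-edges (at least 4), which gives the lower bound.
Equality suggests mapping vertices into the kernel of Q: the rows of A - sI, suitably scaled, attain
the bound. -/

/-! ### Upper bounds from explicit coordinates -/

/-- An embedding given by coordinates indexed by any finite type. -/
theorem mem_distortionSet_of_sq {X ι : Type*} [Fintype ι] {d : X → X → ℝ} (hd : ∀ x y, 0 ≤ d x y)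
    {D : ℝ} (hD : 0 ≤ D) (f : X → ι → ℝ)
    (h : ∀ x y, d x y ^ 2 ≤ ∑ i, (f x i - f y i) ^ 2 ∧
      ∑ i, (f x i - f y i) ^ 2 ≤ D ^ 2 * d x y ^ 2) : D ∈ distortionSet d := by
  let e := Fintype.equivFin ι
  refine ⟨Fintype.card ι, fun x => WithLp.toLp 2 fun j => f x (e.symm j), hD, fun x y => ?_⟩
  have key : ‖(WithLp.toLp 2 fun j => f x (e.symm j) : EuclideanSpace ℝ (Fin (Fintype.card ι))) -
      WithLp.toLp 2 fun j => f y (e.symm j)‖ ^ 2 = ∑ i, (f x i - f y i) ^ 2 := by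
    rw [EuclideanSpace.norm_sq_eq, ← e.symm.sum_comp]
    simp
  obtain ⟨h1, h2⟩ := h x y
  rw [← key] at h1 h2
  refine ⟨abs_le_of_sq_le_sq' h1 (norm_nonneg _) |>.2, ?_⟩
  rw [← mul_pow] at h2
  exact abs_le_of_sq_le_sq' h2 (mul_nonneg hD (hd x y)) |>.2

/-- If a distance `d` is bounded by `n` and `√d` embeds isometrically, then `d` embeds with
distortion `√n`. -/
theorem sqrt_mem_distortionSet {X ι : Type*} [Fintype ι] {d : X → X → ℝ} {m : X → X → ℕ} {n : ℕ}
    (hd : ∀ x y, d x y = m x y) (hm : ∀ x y, m x y ≤ n) (f : X → ι → ℝ)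
    (hf : ∀ x y, ∑ i, (f x i - f y i) ^ 2 = 2 * m x y) : √(n : ℝ) ∈ distortionSet d := by
  -- The factor √(n/2) turns the squared distances `2 * m` into `n * m`.
  refine mem_distortionSet_of_sq (fun x y => by rw [hd]; positivity) (by positivity)
    (fun x i => √((n : ℝ) / 2) * f x i) fun x y => ?_
  have h1 : ∑ i, (√((n : ℝ) / 2) * f x i - √((n : ℝ) / 2) * f y i) ^ 2 = n * m x y := by
    simp_rw [← mul_sub, mul_pow]
    rw [← Finset.mul_sum, hf, Real.sq_sqrt (by positivity)]
    ring
  have h2 : (m x y : ℝ) ≤ n := by exact_mod_cast hm x y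
  have h3 : (m x y : ℝ) ≤ (m x y : ℝ) ^ 2 := by exact_mod_cast Nat.le_self_pow two_ne_zero _
  rw [h1, hd, Real.sq_sqrt (by positivity)]
  constructor
  · rw [sq]; gcongr
  · gcongr

/-! ### Enflo's inequality and the lower bound √n -/

/-- The right side exceeds the left by exactly ‖a - b + c - d‖². -/
theorem quadrilateral_inequality {E : Type*} [NormedAddCommGroup E] [InnerProductSpace ℝ E]
    (a b c d : E) :
    ‖a - c‖ ^ 2 + ‖b - d‖ ^ 2 ≤ ‖a - b‖ ^ 2 + ‖c - d‖ ^ 2 + ‖b - c‖ ^ 2 + ‖a - d‖ ^ 2 := by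
  have h1 : a - c = (a - b) + (b - c) := by abel
  have h2 : b - d = (b - c) + (c - d) := by abel
  have h3 : a - d = (a - b) + (b - c) + (c - d) := by abel
  rw [h1, h2, h3, norm_add_sq_real, norm_add_sq_real (b - c), norm_add_sq_real (_ + _),
    norm_add_sq_real (a - b) (b - c), inner_add_left]
  have := norm_add_sq_real (a - b) (c - d)
  nlinarith [sq_nonneg ‖(a - b) + (c - d)‖]

/-- Enflo's inequality: on the cube, the sum of the squared diagonals is at most the sum of the
squared edges. -/
theorem cube_diagonal_sum_le {E : Type*} [NormedAddCommGroup E] [InnerProductSpace ℝ E] :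
    ∀ (n : ℕ) (f : (Fin n → Bool) → E),
      ∑ x, ‖f x - f (fun i => !x i)‖ ^ 2 ≤
        ∑ x, ∑ i, ‖f x - f (Function.update x i (!x i))‖ ^ 2
  | 0, f => by
      refine Finset.sum_le_sum fun x _ => ?_
      rw [Subsingleton.elim (fun i => !x i) x]
      simp
  | n + 1, f => by
      let c : Bool → (Fin n → Bool) → (Fin (n + 1) → Bool) := fun b x => Fin.cons b x
      have hsum : ∀ F : (Fin (n + 1) → Bool) → ℝ,
          ∑ x, F x = ∑ x, (F (c false x) + F (c true x)) := fun F => by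
        rw [← (Fin.consEquiv fun _ => Bool).sum_comp, Fintype.sum_prod_type]
        simp [Fin.consEquiv, c, Finset.sum_add_distrib, add_comm]
      have hneg : ∀ b x, (fun i => !(c b x i)) = c (!b) (fun i => !x i) := fun b x => by
        funext i
        refine Fin.cases ?_ (fun j => ?_) i <;> simp [c]
      have hzero : ∀ b x, Function.update (c b x) 0 (!(c b x 0)) = c (!b) x := fun b x => by
        simp [c, Fin.update_cons_zero]
      have hsucc : ∀ b x i, Function.update (c b x) (Fin.succ i) (!(c b x (Fin.succ i))) =
          c b (Function.update x i (!x i)) := fun b x i => by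
        simp [c, Fin.cons_update]
      have hinv : ∀ F : (Fin n → Bool) → ℝ, ∑ x : Fin n → Bool, F (fun i => !x i) = ∑ x, F x := fun F =>
        Equiv.sum_comp (Function.Involutive.toPerm (fun (x : Fin n → Bool) (i : Fin n) => !x i)
          fun x => by simp) F
      rw [hsum, hsum]
      simp only [hneg, Fin.sum_univ_succ, hzero, hsucc, Bool.not_false, Bool.not_true]
      have ih0 := cube_diagonal_sum_le n fun x => f (c false x)
      have ih1 := cube_diagonal_sum_le n fun x => f (c true x)
      -- The quadrilateral (0,x), (1,x), (1,x̄), (0,x̄) has two main diagonals of the cube as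
      -- diagonals; its sides are two edges in direction 0 and a diagonal of each facet, the latter
      -- bounded by induction.
      have hq : ∑ x, (‖f (c false x) - f (c true fun i => !x i)‖ ^ 2 +
          ‖f (c true x) - f (c false fun i => !x i)‖ ^ 2) ≤
          ∑ x, (‖f (c false x) - f (c true x)‖ ^ 2 +
            ‖f (c true fun i => !x i) - f (c false fun i => !x i)‖ ^ 2 +
            ‖f (c true x) - f (c true fun i => !x i)‖ ^ 2 +
            ‖f (c false x) - f (c false fun i => !x i)‖ ^ 2) :=
        Finset.sum_le_sum fun x _ => quadrilateral_inequality _ _ _ _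
      have h4 := hinv fun x => ‖f (c true x) - f (c false x)‖ ^ 2
      simp only [Finset.sum_add_distrib] at hq ⊢
      linarith

/-- A distance containing an isometric copy of the `n`-cube has distortion at least `√n`. -/
theorem sqrt_le_of_cube {X : Type*} {d : X → X → ℝ} {n : ℕ} (φ : (Fin n → Bool) → X)
    (hφ : ∀ x y, d (φ x) (φ y) = hammingDist x y) {D : ℝ} (hD : D ∈ distortionSet d) :
    √(n : ℝ) ≤ D := by
  obtain ⟨N, ρ, hD0, h⟩ := hD
  rw [Real.sqrt_le_left hD0]
  have hdiag : ∀ x : Fin n → Bool, (n : ℝ) ^ 2 ≤ ‖ρ (φ x) - ρ (φ fun i => !x i)‖ ^ 2 := by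
    intro x
    have := (h (φ x) (φ fun i => !x i)).1
    rw [hφ] at this
    have hn : hammingDist x (fun i => !x i) = n := by simp [hammingDist]
    rw [hn] at this
    gcongr
  have hedge : ∀ (x : Fin n → Bool) (i : Fin n),
      ‖ρ (φ x) - ρ (φ (Function.update x i (!x i)))‖ ^ 2 ≤ D ^ 2 := by
    intro x i
    have := (h (φ x) (φ (Function.update x i (!x i)))).2
    have hn : hammingDist x (Function.update x i (!x i)) = 1 := by
      rw [hammingDist, Finset.card_eq_one]
      refine ⟨i, ?_⟩
      ext j
      by_cases hj : j = i
      · subst hj; simp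
      · simp [hj]
    rw [hφ, hn, Nat.cast_one, mul_one] at this
    gcongr
  have h1 : ∑ _x : Fin n → Bool, (n : ℝ) ^ 2 ≤ ∑ _x : Fin n → Bool, ∑ _i : Fin n, D ^ 2 :=
    (Finset.sum_le_sum fun x _ => hdiag x).trans ((cube_diagonal_sum_le n fun x => ρ (φ x)).trans
      (Finset.sum_le_sum fun x _ => Finset.sum_le_sum fun i _ => hedge x i))
  simp only [Finset.sum_const, nsmul_eq_mul, Finset.card_univ, Fintype.card_fin] at h1
  have h2 := le_of_mul_le_mul_left h1 (by simp)
  rcases Nat.eq_zero_or_pos n with rfl | hn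
  · simpa using sq_nonneg D
  · have hn' : (0 : ℝ) < n := by exact_mod_cast hn
    rw [sq] at h2
    exact le_of_mul_le_mul_left h2 hn'

/-! ### Hamming and Johnson graphs -/

/-- Each step of a walk lowers the distance candidate `f` by at most one, so no walk is shorter than
`f x y`; iterating the descent builds a walk of that length. -/
theorem SimpleGraph.dist_eq_of_descent {V : Type*} {G : SimpleGraph V} (f : V → V → ℕ)
    (h0 : ∀ x, f x x = 0) (heq : ∀ x y, f x y = 0 → x = y)
    (hadj : ∀ x y z, G.Adj x y → f x z ≤ f y z + 1)
    (hdesc : ∀ x y m, f x y = m + 1 → ∃ z, G.Adj x z ∧ f z y = m) (x y : V) :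
    G.dist x y = f x y := by
  have hup : ∀ m x y, f x y = m → ∃ p : G.Walk x y, p.length = m := by
    intro m
    induction m with
    | zero =>
      intro x y h
      obtain rfl := heq x y h
      exact ⟨.nil, rfl⟩
    | succ m ih =>
      intro x y h
      obtain ⟨z, hz, hzy⟩ := hdesc x y m h
      obtain ⟨p, hp⟩ := ih z y hzy
      exact ⟨.cons hz p, by simp [hp]⟩
  have hlow : ∀ (x y : V) (p : G.Walk x y), f x y ≤ p.length := by
    intro x y p
    induction p with
    | nil => simp [h0]
    | cons h p ih => simpa using (hadj _ _ _ h).trans (by gcongr)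
  obtain ⟨p, hp⟩ := hup _ x y rfl
  refine le_antisymm (hp ▸ SimpleGraph.dist_le p) ?_
  obtain ⟨q, hq⟩ := p.reachable.exists_walk_length_eq_dist
  exact hq ▸ hlow x y q

theorem hammingGraph_dist {X : Type*} [DecidableEq X] {n : ℕ} (x y : Fin n → X) :
    (hammingGraph X n).dist x y = hammingDist x y := by
  refine SimpleGraph.dist_eq_of_descent (fun x y => hammingDist x y) hammingDist_self
    (fun _ _ => hammingDist_eq_zero.1) (fun x y z h => ?_) (fun x y m h => ?_) x y
  · have h' : hammingDist x y = 1 := h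
    have := hammingDist_triangle x y z
    omega
  · obtain ⟨i, hi⟩ : ∃ i, x i ≠ y i := by
      by_contra! hc
      simp [funext hc] at h
    refine ⟨Function.update x i (y i), ?_, ?_⟩
    · change Finset.card _ = 1
      rw [Finset.card_eq_one]
      refine ⟨i, ?_⟩
      ext j
      by_cases hj : j = i
      · subst hj; simpa using hi
      · simp [hj]
    · have : (Finset.univ.filter fun j => Function.update x i (y i) j ≠ y j) =
          (Finset.univ.filter fun j => x j ≠ y j).erase i := by
        ext j
        by_cases hj : j = i
        · subst hj; simp
        · simp [hj]
      simp only [hammingDist] at h ⊢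
      rw [this, Finset.card_erase_of_mem (by simpa using hi), h]
      rfl

theorem isLeastDistortion_hammingGraph (X : Type*) [Fintype X] [DecidableEq X] (n : ℕ)
    (hX : 2 ≤ Fintype.card X) : IsLeastDistortion (hammingGraph X n) (√(n : ℝ)) := by
  constructor
  -- One-hot encoding: every coordinate where the vectors differ contributes 2.
  · refine sqrt_mem_distortionSet (ι := Fin n × X) (m := fun x y => hammingDist x y)
      (fun x y => by rw [pathMetric, hammingGraph_dist])
      (fun x y => by simpa using hammingDist_le_card_fintype (x := x) (y := y))
      (fun x p => if x p.1 = p.2 then 1 else 0) fun x y => ?_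
    rw [Fintype.sum_prod_type, hammingDist, Finset.card_filter]
    push_cast
    rw [Finset.mul_sum]
    refine Finset.sum_congr rfl fun i _ => ?_
    by_cases h : x i = y i
    · simp [h]
    · have : ∀ a : X, ((if x i = a then (1 : ℝ) else 0) - if y i = a then 1 else 0) ^ 2 =
          (if x i = a then 1 else 0) + if y i = a then 1 else 0 := by
        intro a
        split_ifs with h1 h2
        · exact absurd (h1.trans h2.symm) h
        all_goals norm_num
      simp only [this, Finset.sum_add_distrib]
      simp [h]
      norm_num
  · intro D hD
    obtain ⟨e⟩ : Nonempty (Bool ↪ X) :=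
      Function.Embedding.nonempty_of_card_le (by simpa using hX)
    refine sqrt_le_of_cube (fun x i => e (x i)) (fun x y => ?_) hD
    rw [pathMetric, hammingGraph_dist, hammingDist_comp (fun _ => e) fun _ => e.injective]

theorem johnsonGraph_dist {V : Type*} [DecidableEq V] {n : ℕ}
    (s t : {s : Finset V // s.card = n}) :
    (johnsonGraph V n).dist s t = (s.1 \ t.1).card := by
  have hcard : ∀ s t : {s : Finset V // s.card = n}, (s.1 \ t.1).card + (s.1 ∩ t.1).card = n :=
    fun s t => by rw [Finset.card_sdiff_add_card_inter, s.2]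
  refine SimpleGraph.dist_eq_of_descent
    (fun s t : {s : Finset V // s.card = n} => (s.1 \ t.1).card) (fun s => by simp)
    (fun s t h => ?_) (fun s t u h => ?_) (fun s t m h => ?_) s t
  · rw [Finset.card_eq_zero, Finset.sdiff_eq_empty_iff_subset] at h
    exact Subtype.ext (Finset.eq_of_subset_of_card_le h (by rw [s.2, t.2]))
  · have h1 : (s.1 ∩ t.1).card + 1 = n := h
    have h2 := hcard s t
    have h3 : s.1 \ u.1 ⊆ (t.1 \ u.1) ∪ (s.1 \ t.1) := by
      intro a
      simp only [Finset.mem_sdiff, Finset.mem_union]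
      tauto
    have h4 := (Finset.card_le_card h3).trans (Finset.card_union_le _ _)
    omega
  · have h1 := hcard s t
    have h2 := hcard t s
    rw [Finset.inter_comm] at h2
    obtain ⟨a, ha⟩ : (s.1 \ t.1).Nonempty := Finset.card_pos.1 (by omega)
    obtain ⟨b, hb⟩ : (t.1 \ s.1).Nonempty := Finset.card_pos.1 (by omega)
    rw [Finset.mem_sdiff] at ha hb
    have hbe : b ∉ s.1.erase a := fun hh => hb.2 (Finset.mem_of_mem_erase hh)
    have hc : (s.1.erase a).card + 1 = n := by rw [Finset.card_erase_add_one ha.1, s.2]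
    refine ⟨⟨insert b (s.1.erase a), by rw [Finset.card_insert_of_notMem hbe, hc]⟩, ?_, ?_⟩
    · change (s.1 ∩ insert b (s.1.erase a)).card + 1 = n
      rw [Finset.inter_insert_of_notMem hb.2,
        Finset.inter_eq_right.2 (Finset.erase_subset _ _), hc]
    · change (insert b (s.1.erase a) \ t.1).card = m
      rw [Finset.insert_sdiff_of_mem _ hb.1, Finset.erase_sdiff_comm,
        Finset.card_erase_of_mem (by simpa using ha), h]
      rfl

theorem isLeastDistortion_johnsonGraph (V : Type*) [Fintype V] [DecidableEq V] (n : ℕ)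
    (hV : 2 * n ≤ Fintype.card V) : IsLeastDistortion (johnsonGraph V n) (√(n : ℝ)) := by
  constructor
  · refine sqrt_mem_distortionSet (ι := V)
      (m := fun s t : {s : Finset V // s.card = n} => (s.1 \ t.1).card)
      (fun s t => by rw [pathMetric, johnsonGraph_dist])
      (fun s t => (Finset.card_le_card Finset.sdiff_subset).trans s.2.le)
      (fun s a => if a ∈ s.1 then 1 else 0) fun s t => ?_
    have h1 : (s.1 \ t.1).card = (t.1 \ s.1).card := by
      have h1 := Finset.card_sdiff_add_card_inter s.1 t.1
      have h2 := Finset.card_sdiff_add_card_inter t.1 s.1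
      rw [Finset.inter_comm] at h2
      have := s.2
      have := t.2
      omega
    have h2 : ∀ a : V, ((if a ∈ s.1 then (1 : ℝ) else 0) - if a ∈ t.1 then 1 else 0) ^ 2 =
        (if a ∈ s.1 \ t.1 then 1 else 0) + if a ∈ t.1 \ s.1 then 1 else 0 := by
      intro a
      by_cases h1 : a ∈ s.1 <;> by_cases h2 : a ∈ t.1 <;> simp [h1, h2]
    simp only [h2, Finset.sum_add_distrib, Finset.sum_boole, Finset.filter_univ_mem]
    rw [← h1]
    ring
  · intro D hD
    -- Since v ≥ 2n there are n disjoint pairs of points; choosing one point from each pair gives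
    -- the cube.
    obtain ⟨e⟩ : Nonempty (Fin n × Bool ↪ V) :=
      Function.Embedding.nonempty_of_card_le (by simpa [mul_comm] using hV)
    have hinj : ∀ x : Fin n → Bool, Function.Injective fun i => e (i, x i) := fun x i j h => by
      have := e.injective h
      simp only [Prod.mk.injEq] at this
      exact this.1
    refine sqrt_le_of_cube (fun x => ⟨Finset.univ.image fun i => e (i, x i), by
      rw [Finset.card_image_of_injective _ (hinj x), Finset.card_univ, Fintype.card_fin]⟩)
      (fun x y => ?_) hD
    rw [pathMetric, johnsonGraph_dist, hammingDist]
    refine congrArg _ (Eq.trans ?_ (Finset.card_image_of_injective _ (hinj x)))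
    refine congrArg _ ?_
    ext a
    simp only [Finset.mem_sdiff, Finset.mem_image, Finset.mem_univ, true_and, Finset.mem_filter]
    constructor
    · rintro ⟨⟨i, rfl⟩, h⟩
      exact ⟨i, fun hi => h ⟨i, by rw [hi]⟩, rfl⟩
    · rintro ⟨i, hi, rfl⟩
      refine ⟨⟨i, rfl⟩, ?_⟩
      rintro ⟨j, hj⟩
      have := e.injective hj
      simp only [Prod.mk.injEq] at this
      obtain ⟨rfl, h⟩ := this
      exact hi h.symm

/-! ### Strongly regular graphs: adjacency algebra and eigenvalues -/

namespace SimpleGraph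

section

variable {V : Type*} {G : SimpleGraph V}

theorem dist_eq_two (hG : G.ediam = 2) {x y : V} (hxy : x ≠ y) (h : ¬G.Adj x y) :
    G.dist x y = 2 := by
  have htop : G.ediam ≠ ⊤ := by rw [hG]; decide
  have hle : G.dist x y ≤ 2 := by
    simpa [diam, hG] using dist_le_diam htop (u := x) (v := y)
  have h0 : G.dist x y ≠ 0 := fun h0 =>
    hxy ((preconnected_of_ediam_ne_top htop x y).dist_eq_zero_iff.1 h0)
  have h1 : G.dist x y ≠ 1 := fun h1 => h (dist_eq_one_iff_adj.1 h1)
  omega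

theorem exists_common_neighbor_of_ediam_eq_two (hG : G.ediam = 2) {x y : V} (hxy : x ≠ y)
    (h : ¬G.Adj x y) : ∃ z, G.Adj x z ∧ G.Adj z y := by
  have h2 : ¬2 < G.edist x y := not_lt.2 (hG ▸ edist_le_ediam)
  rw [two_lt_edist_iff] at h2
  obtain ⟨z, hz⟩ : (G.commonNeighbors x y).Nonempty := by
    rw [Set.nonempty_iff_ne_empty]
    exact fun h3 => h2 ⟨hxy, h, h3⟩
  rw [mem_commonNeighbors] at hz
  exact ⟨z, hz.1, hz.2.symm⟩

theorem exists_not_adj_of_ediam_eq_two (hG : G.ediam = 2) : ∃ x y, x ≠ y ∧ ¬G.Adj x y := by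
  have : Nontrivial V := nontrivial_of_ediam_ne_zero (G := G) (by rw [hG]; decide)
  by_contra! hc
  have : G = ⊤ := by
    ext x y
    exact ⟨fun h => h.ne, fun h => hc x y h⟩
  rw [ediam_eq_one.2 this] at hG
  exact absurd hG (by decide)

end

/-- The entries of `A - θ I`, where `A` is the adjacency matrix of `G`. -/
def shiftedAdj {V : Type*} [DecidableEq V] (G : SimpleGraph V) [DecidableRel G.Adj] (θ : ℝ)
    (x y : V) : ℝ :=
  (if G.Adj x y then 1 else 0) - if x = y then θ else 0

section

variable {V : Type*} [DecidableEq V] {G : SimpleGraph V} [DecidableRel G.Adj]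

theorem shiftedAdj_comm (θ : ℝ) (x y : V) : G.shiftedAdj θ x y = G.shiftedAdj θ y x := by
  simp only [shiftedAdj, G.adj_comm x y, eq_comm (a := x)]

theorem shiftedAdj_self (θ : ℝ) (x : V) : G.shiftedAdj θ x x = -θ := by
  simp [shiftedAdj]

theorem shiftedAdj_of_adj (θ : ℝ) {x y : V} (h : G.Adj x y) : G.shiftedAdj θ x y = 1 := by
  simp [shiftedAdj, h, h.ne]

theorem shiftedAdj_of_not_adj (θ : ℝ) {x y : V} (hxy : x ≠ y) (h : ¬G.Adj x y) :
    G.shiftedAdj θ x y = 0 := by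
  simp [shiftedAdj, h, hxy]

end

section

variable {V : Type*} [Fintype V] [DecidableEq V] {G : SimpleGraph V} [DecidableRel G.Adj]

theorem IsRegularOfDegree.sum_shiftedAdj {k : ℕ} (h : G.IsRegularOfDegree k) (θ : ℝ) (x : V) :
    ∑ y, G.shiftedAdj θ x y = k - θ := by
  simp [shiftedAdj, Finset.sum_sub_distrib, ← h.degree_eq x, ← card_neighborFinset_eq_degree,
    neighborFinset_eq_filter]

theorem sum_shiftedAdj_mul (θ : ℝ) (x : V) (u : V → ℝ) :
    ∑ y, G.shiftedAdj θ x y * u y = (G.adjMatrix ℝ).mulVec u x - θ * u x := by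
  simp [shiftedAdj, sub_mul, Finset.sum_sub_distrib, Matrix.mulVec, dotProduct]

theorem hasEigenvalue_adjMatrix_iff {θ : ℝ} :
    Module.End.HasEigenvalue (Matrix.toLin' (G.adjMatrix ℝ)) θ ↔
      ∃ u : V → ℝ, u ≠ 0 ∧ ∀ x, ∑ y, G.shiftedAdj θ x y * u y = 0 := by
  have key : ∀ u : V → ℝ, Matrix.toLin' (G.adjMatrix ℝ) u = θ • u ↔
      ∀ x, ∑ y, G.shiftedAdj θ x y * u y = 0 := fun u => by
    simp only [sum_shiftedAdj_mul, sub_eq_zero, funext_iff, Matrix.toLin'_apply, Pi.smul_apply,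
      smul_eq_mul]
  constructor
  · intro h
    obtain ⟨u, hu⟩ := h.exists_hasEigenvector
    exact ⟨u, hu.2, (key u).1 (Module.End.mem_eigenspace_iff.1 hu.1)⟩
  · rintro ⟨u, hu, h⟩
    exact Module.End.hasEigenvalue_of_hasEigenvector
      ⟨Module.End.mem_eigenspace_iff.2 ((key u).2 h), hu⟩

namespace IsSRGWith

variable {ν k l μ : ℕ}

theorem sum_adj_mul_adj (h : G.IsSRGWith ν k l μ) (x y : V) :
    ∑ z, G.shiftedAdj 0 x z * G.shiftedAdj 0 z y =
      ((k : ℝ) - μ) * (if x = y then 1 else 0) + ((l : ℝ) - μ) * G.shiftedAdj 0 x y + μ := by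
  have := congrFun (congrFun (h.matrix_eq (α := ℝ)) x) y
  rw [pow_two, Matrix.mul_apply, Matrix.add_apply, Matrix.add_apply, Matrix.smul_apply,
    Matrix.smul_apply, Matrix.smul_apply] at this
  simp only [shiftedAdj, ite_self, sub_zero]
  simp only [adjMatrix_apply] at this
  rw [this]
  by_cases hxy : x = y
  · subst hxy; simp
  · by_cases ha : G.Adj x y <;> simp [hxy, ha]

/-- `(A - θ I) (A - θ' I) = μ J` for the two roots `θ`, `θ'`. -/
theorem sum_shiftedAdj_mul_shiftedAdj (h : G.IsSRGWith ν k l μ) {θ θ' : ℝ}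
    (hadd : θ + θ' = l - μ) (hmul : θ * θ' = μ - k) (x y : V) :
    ∑ z, G.shiftedAdj θ x z * G.shiftedAdj θ' z y = μ := by
  have h1 := h.sum_adj_mul_adj x y
  have h2 : ∀ z, G.shiftedAdj θ x z * G.shiftedAdj θ' z y =
      G.shiftedAdj 0 x z * G.shiftedAdj 0 z y - (if x = z then θ * G.shiftedAdj 0 z y else 0) -
        (if z = y then θ' * G.shiftedAdj 0 x z else 0) +
        (if x = z then (if z = y then θ * θ' else 0) else 0) := fun z => by
    simp only [shiftedAdj, ite_self, sub_zero]
    split_ifs <;> ring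
  simp only [h2, Finset.sum_add_distrib, Finset.sum_sub_distrib, h1, Finset.sum_ite_eq,
    Finset.sum_ite_eq', Finset.mem_univ, if_true]
  rw [← hadd, hmul]
  split_ifs <;> ring

/-- Writing one factor A - θI as (A - θ'I) + (θ' - θ)I reduces the Gram matrix of the rows to the
relation for the two roots. -/
theorem sum_shiftedAdj_mul_self (h : G.IsSRGWith ν k l μ) {θ θ' : ℝ}
    (hadd : θ + θ' = l - μ) (hmul : θ * θ' = μ - k) (x y : V) :
    ∑ z, G.shiftedAdj θ x z * G.shiftedAdj θ y z = (θ' - θ) * G.shiftedAdj θ x y + μ := by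
  have h2 : ∀ z, G.shiftedAdj θ x z * G.shiftedAdj θ y z =
      G.shiftedAdj θ x z * G.shiftedAdj θ' z y +
        if z = y then (θ' - θ) * G.shiftedAdj θ x z else 0 := fun z => by
    rw [shiftedAdj_comm θ y z]
    by_cases hz : z = y
    · subst hz; simp only [shiftedAdj_self, if_true]; ring
    · simp [shiftedAdj, hz]
  simp only [h2, Finset.sum_add_distrib, h.sum_shiftedAdj_mul_shiftedAdj hadd hmul,
    Finset.sum_ite_eq', Finset.mem_univ, if_true]
  ring

theorem sum_sq_shiftedAdj_sub (h : G.IsSRGWith ν k l μ) {θ θ' : ℝ}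
    (hadd : θ + θ' = l - μ) (hmul : θ * θ' = μ - k) (x y : V) :
    ∑ z, (G.shiftedAdj θ x z - G.shiftedAdj θ y z) ^ 2 =
      (θ' - θ) * (-2 * θ - 2 * G.shiftedAdj θ x y) := by
  have h2 : ∀ z, (G.shiftedAdj θ x z - G.shiftedAdj θ y z) ^ 2 =
      G.shiftedAdj θ x z * G.shiftedAdj θ x z + G.shiftedAdj θ y z * G.shiftedAdj θ y z -
        2 * (G.shiftedAdj θ x z * G.shiftedAdj θ y z) := fun z => by ring
  simp only [h2, Finset.sum_add_distrib, Finset.sum_sub_distrib, ← Finset.mul_sum,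
    h.sum_shiftedAdj_mul_self hadd hmul, shiftedAdj_self]
  ring

/-- Relations among the parameters of a strongly regular graph of diameter `2` and the roots
`r`, `s` of `θ ^ 2 - (l - μ) θ - (k - μ)`. -/
theorem param_relations (h : G.IsSRGWith ν k l μ) (hG : G.ediam = 2) {r : ℝ}
    (hr : r = (1 / 2 : ℝ) * ((l : ℝ) - μ + √(((l : ℝ) - μ) ^ 2 + 4 * ((k : ℝ) - μ)))) :
    ∃ s : ℝ, r + s = l - μ ∧ r * s = μ - k ∧ 0 ≤ r ∧ s < 0 ∧ r < k ∧
      (k - r) * (k - s) = ν * μ ∧ (0 : ℝ) < μ ∧ (0 : ℝ) < k ∧ (0 : ℝ) < ν - k - 1 ∧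
      (k : ℝ) * (k - l - 1) = (ν - k - 1) * μ := by
  obtain ⟨x, y, hxy, hna⟩ := exists_not_adj_of_ediam_eq_two hG
  obtain ⟨z, hxz, hzy⟩ := exists_common_neighbor_of_ediam_eq_two hG hxy hna
  have hrow : ∀ w, ∑ z, G.shiftedAdj 0 w z = k := fun w => by
    simpa using h.regular.sum_shiftedAdj 0 w
  have hnn : ∀ u w, 0 ≤ G.shiftedAdj 0 u w := fun u w => by
    simp only [shiftedAdj, ite_self, sub_zero]; split_ifs <;> norm_num
  have hle1 : ∀ u w, G.shiftedAdj 0 u w ≤ 1 := fun u w => by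
    simp only [shiftedAdj, ite_self, sub_zero]; split_ifs <;> norm_num
  have hxysum := h.sum_adj_mul_adj x y
  rw [if_neg hxy, shiftedAdj_of_not_adj 0 hxy hna] at hxysum
  simp only [mul_zero, zero_add] at hxysum
  have hμ : (0 : ℝ) < μ := by
    have := Finset.single_le_sum (f := fun z => G.shiftedAdj 0 x z * G.shiftedAdj 0 z y)
      (fun i _ => mul_nonneg (hnn _ _) (hnn _ _)) (Finset.mem_univ z)
    rw [hxysum, shiftedAdj_of_adj 0 hxz, shiftedAdj_of_adj 0 hzy] at this
    linarith
  have hμk : (μ : ℝ) ≤ k := by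
    rw [← hxysum, ← hrow x]
    exact Finset.sum_le_sum fun z _ => mul_le_of_le_one_right (hnn _ _) (hle1 _ _)
  have hk : (0 : ℝ) < k := hμ.trans_le hμk
  have hcard : (Fintype.card V : ℝ) = ν := by exact_mod_cast h.card
  have hν : (0 : ℝ) < ν - k - 1 := by
    have := Finset.single_le_sum
      (f := fun z => 1 - (if x = z then 1 else 0) - G.shiftedAdj 0 x z)
      (fun i _ => by
        by_cases hi : x = i
        · subst hi; simp [shiftedAdj_self]
        · simpa [hi] using hle1 x i) (Finset.mem_univ y)
    simp only [Finset.sum_sub_distrib, hrow] at this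
    simp [hxy, shiftedAdj_of_not_adj 0 hxy hna, hcard] at this
    linarith
  -- Walks of length two from x are counted in two ways.
  have hparam : (k : ℝ) * (k - l - 1) = (ν - k - 1) * μ := by
    have h1 : ∑ w, ∑ z, G.shiftedAdj 0 x z * G.shiftedAdj 0 z w = (k : ℝ) * k := by
      rw [Finset.sum_comm]
      simp only [← Finset.mul_sum, hrow, ← Finset.sum_mul]
    simp only [h.sum_adj_mul_adj, Finset.sum_add_distrib, ← Finset.mul_sum, hrow] at h1
    simp [hcard] at h1
    linarith
  have hl : (l : ℝ) < k := by
    have : 0 < (k : ℝ) * (k - l - 1) := hparam ▸ mul_pos hν hμ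
    have := pos_of_mul_pos_right this hk.le
    linarith
  set p : ℝ := l - μ with hp
  set R := √(p ^ 2 + 4 * ((k : ℝ) - μ)) with hR
  have hR2 : R ^ 2 = p ^ 2 + 4 * ((k : ℝ) - μ) :=
    Real.sq_sqrt (by have := sq_nonneg p; linarith)
  have hR0 : 0 ≤ R := Real.sqrt_nonneg _
  have hpR : p < R := by
    rcases hμk.lt_or_eq with hlt | heq
    · exact Real.lt_sqrt_of_sq_lt (by linarith)
    -- If μ = k, then p = l - k is negative.
    · exact lt_of_lt_of_le (by linarith) hR0
  have hpR' : -p ≤ R := Real.le_sqrt_of_sq_le (by rw [neg_sq]; linarith)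
  have hadd : r + (p - R) / 2 = p := by rw [hr]; ring
  have hmul : r * ((p - R) / 2) = μ - k := by rw [hr]; linear_combination (-1 / 4) * hR2
  have hprod : ((k : ℝ) - r) * (k - (p - R) / 2) = ν * μ := by
    linear_combination (-(k : ℝ)) * hadd + hmul + hparam - (k : ℝ) * hp
  have hs : (p - R) / 2 < 0 := by linarith
  refine ⟨(p - R) / 2, hadd, hmul, by rw [hr]; linarith, hs, ?_, hprod, hμ, hk, hν, hparam⟩
  have h1 : 0 < ((k : ℝ) - r) * (k - (p - R) / 2) := by
    rw [hprod]
    exact mul_pos (by linarith) hμ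
  have := pos_of_mul_pos_left h1 (by linarith)
  linarith

theorem isGreatest_eigenvalue (h : G.IsSRGWith ν k l μ) (hG : G.ediam = 2) {r : ℝ}
    (hr : r = (1 / 2 : ℝ) * ((l : ℝ) - μ + √(((l : ℝ) - μ) ^ 2 + 4 * ((k : ℝ) - μ)))) :
    IsGreatest {θ : ℝ | θ ≠ k ∧
      Module.End.HasEigenvalue (Matrix.toLin' (G.adjMatrix ℝ)) θ} r := by
  obtain ⟨s, hadd, hmul, hr0, hs, hrk, -⟩ := h.param_relations hG hr
  constructor
  · refine ⟨hrk.ne, hasEigenvalue_adjMatrix_iff.2 ?_⟩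
    obtain ⟨x, y, hxy, hna⟩ := exists_not_adj_of_ediam_eq_two hG
    obtain ⟨z, hxz, -⟩ := exists_common_neighbor_of_ediam_eq_two hG hxy hna
    -- The difference of two columns of A - sI is killed by A - rI, since μJ has equal columns; its
    -- entry at x is 1, so it is nonzero.
    refine ⟨fun w => G.shiftedAdj s w z - G.shiftedAdj s w y, fun h0 => ?_, fun v => ?_⟩
    · have := congrFun h0 x
      simp [shiftedAdj_of_adj s hxz, shiftedAdj_of_not_adj s hxy hna] at this
    · simp only [mul_sub, Finset.sum_sub_distrib, h.sum_shiftedAdj_mul_shiftedAdj hadd hmul,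
        sub_self]
  · rintro θ ⟨hθk, hθ⟩
    obtain ⟨u, hu, hev⟩ := hasEigenvalue_adjMatrix_iff.1 hθ
    -- An eigenvector for θ ≠ k is orthogonal to the constants, so J kills it and θ is r or s.
    have hsum : ∑ x, u x = 0 := by
      have h1 : ∑ x, ∑ y, G.shiftedAdj θ x y * u y = (k - θ) * ∑ x, u x := by
        rw [Finset.sum_comm, Finset.mul_sum]
        refine Finset.sum_congr rfl fun y _ => ?_
        rw [← Finset.sum_mul, ← h.regular.sum_shiftedAdj θ y]
        simp only [shiftedAdj_comm θ y]
      simp only [hev, Finset.sum_const_zero] at h1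
      exact (mul_eq_zero.1 h1.symm).resolve_left (sub_ne_zero.2 hθk.symm)
    have hshift : ∀ η x, ∑ y, G.shiftedAdj η x y * u y = (θ - η) * u x := fun η x => by
      have := hev x
      rw [sum_shiftedAdj_mul] at this ⊢
      linarith
    obtain ⟨x, hx⟩ := Function.ne_iff.1 hu
    have h2 : ∑ y, G.shiftedAdj r x y * ∑ z, G.shiftedAdj s y z * u z = 0 := by
      simp only [Finset.mul_sum, ← mul_assoc]
      rw [Finset.sum_comm]
      simp only [← Finset.sum_mul, h.sum_shiftedAdj_mul_shiftedAdj hadd hmul]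
      rw [← Finset.mul_sum, hsum, mul_zero]
    have h3 : (θ - s) * ((θ - r) * u x) = 0 := by
      rw [← h2, ← hshift r x, Finset.mul_sum]
      refine Finset.sum_congr rfl fun y _ => ?_
      rw [hshift s y]
      ring
    rcases mul_eq_zero.1 h3 with h4 | h4
    · linarith
    · have := (mul_eq_zero.1 h4).resolve_right hx
      linarith

end IsSRGWith

end

end SimpleGraph

/-! ### Distortion of strongly regular graphs -/

/-- A symmetric matrix `Q` with `Q ^ 2 = t Q`, `t > 0`, and zero row sums pairs nonpositively with
squared Euclidean distances. -/
theorem sum_mul_norm_sub_sq_nonpos {V E : Type*} [Fintype V] [NormedAddCommGroup E]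
    [InnerProductSpace ℝ E] {Q : V → V → ℝ} {t : ℝ} (ht : 0 < t) (hrow : ∀ x, ∑ y, Q x y = 0)
    (hcomm : ∀ x y, Q x y = Q y x) (hsq : ∀ x y, ∑ z, Q x z * Q y z = t * Q x y) (ρ : V → E) :
    ∑ x, ∑ y, Q x y * ‖ρ x - ρ y‖ ^ 2 ≤ 0 := by
  -- Since Q² = tQ, t times the quadratic form of Q is a sum of squares; zero row sums remove the
  -- terms ‖ρ x‖² and ‖ρ y‖².
  have h1 : ∑ z, ‖∑ x, Q x z • ρ x‖ ^ 2 = t * ∑ x, ∑ y, Q x y * inner ℝ (ρ x) (ρ y) := by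
    simp only [← real_inner_self_eq_norm_sq, sum_inner, inner_sum, real_inner_smul_left,
      real_inner_smul_right, ← mul_assoc, Finset.mul_sum, ← hsq, Finset.sum_mul]
    rw [Finset.sum_comm]
    refine Finset.sum_congr rfl fun x _ => ?_
    rw [Finset.sum_comm]
    simp only [real_inner_comm]
  have h2 : 0 ≤ ∑ x, ∑ y, Q x y * inner ℝ (ρ x) (ρ y) := by
    refine nonneg_of_mul_nonneg_right ?_ ht
    rw [← h1]
    positivity
  have h3 : ∑ x, ∑ y, Q x y * ‖ρ x‖ ^ 2 = 0 := by
    simp [← Finset.sum_mul, hrow]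
  have h4 : ∑ x, ∑ y, Q x y * ‖ρ y‖ ^ 2 = 0 := by
    rw [Finset.sum_comm]
    simp [← Finset.sum_mul, fun y => (Finset.sum_congr rfl fun x _ => hcomm x y).trans (hrow y)]
  have h5 : ∀ x y, Q x y * ‖ρ x - ρ y‖ ^ 2 = Q x y * ‖ρ x‖ ^ 2 + Q x y * ‖ρ y‖ ^ 2 -
      2 * (Q x y * inner ℝ (ρ x) (ρ y)) := fun x y => by
    rw [norm_sub_sq_real]
    ring
  simp only [h5, Finset.sum_add_distrib, Finset.sum_sub_distrib, ← Finset.mul_sum, h3, h4]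
  linarith

namespace SimpleGraph.IsSRGWith

variable {V : Type*} [Fintype V] [DecidableEq V] {G : SimpleGraph V} [DecidableRel G.Adj]
  {ν k l μ : ℕ}

theorem le_of_mem_distortionSet (h : G.IsSRGWith ν k l μ) (hG : G.ediam = 2) {r : ℝ}
    (hr : r = (1 / 2 : ℝ) * ((l : ℝ) - μ + √(((l : ℝ) - μ) ^ 2 + 4 * ((k : ℝ) - μ)))) {D : ℝ}
    (hD : D ∈ distortionSet (pathMetric G)) :
    √((4 * ((ν : ℝ) - k - 1) * (k - r)) / (k * (ν - k + r))) ≤ D := by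
  obtain ⟨s, hadd, hmul, hr0, hs, hrk, hprod, hμ, hk, hν, -⟩ := h.param_relations hG hr
  obtain ⟨N, ρ, hD0, hρ⟩ := hD
  have hν0 : (0 : ℝ) < ν := by linarith
  have hcard : (Fintype.card V : ℝ) = ν := by exact_mod_cast h.card
  -- This c makes the row sums of cJ - (A - rI) vanish.
  obtain ⟨c, hc⟩ : ∃ c : ℝ, c * ν = k - r := ⟨(k - r) / ν, div_mul_cancel₀ _ hν0.ne'⟩
  have hc0 : 0 < c := pos_of_mul_pos_left (by rw [hc]; linarith) hν0.le
  have hc1 : c ≤ 1 := by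
    refine le_of_mul_le_mul_right ?_ hν0
    linarith
  have hcs : c * (k - s) = μ := by
    refine mul_right_cancel₀ hν0.ne' ?_
    linear_combination (k - s) * hc + hprod
  have hQ := sum_mul_norm_sub_sq_nonpos (Q := fun x y => c - G.shiftedAdj r x y) (t := r - s)
    (by linarith)
    (fun x => by
      rw [Finset.sum_sub_distrib, h.regular.sum_shiftedAdj]
      simp [hcard]
      linarith)
    (fun x y => by rw [shiftedAdj_comm])
    (fun x y => by
      have h2 : ∀ z, (c - G.shiftedAdj r x z) * (c - G.shiftedAdj r y z) =
          c * c - c * G.shiftedAdj r x z - c * G.shiftedAdj r y z +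
            G.shiftedAdj r x z * G.shiftedAdj r y z := fun z => by ring
      simp only [h2, Finset.sum_add_distrib, Finset.sum_sub_distrib, ← Finset.mul_sum,
        h.sum_shiftedAdj_mul_self hadd hmul, h.regular.sum_shiftedAdj]
      simp [hcard]
      linear_combination c * hc - hcs) ρ
  -- The left side encodes 0 on the diagonal, (c - 1)D² on edges and 4c on non-edges, so that it
  -- sums by regularity.
  have hterm : ∀ x y, 4 * c * (1 - if x = y then 1 else 0) -
      (4 * c + (1 - c) * D ^ 2) * G.shiftedAdj 0 x y ≤
      (c - G.shiftedAdj r x y) * ‖ρ x - ρ y‖ ^ 2 := by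
    intro x y
    obtain ⟨h1, h2⟩ := hρ x y
    by_cases hxy : x = y
    · subst hxy
      simp [shiftedAdj_self]
    · by_cases ha : G.Adj x y
      · rw [pathMetric, dist_eq_one_iff_adj.2 ha, Nat.cast_one, mul_one] at h2
        have h3 : ‖ρ x - ρ y‖ ^ 2 ≤ D ^ 2 := by gcongr
        simp only [hxy, if_false, shiftedAdj_of_adj _ ha]
        nlinarith
      · rw [pathMetric, dist_eq_two hG hxy ha] at h1
        have h3 : ((2 : ℕ) : ℝ) ^ 2 ≤ ‖ρ x - ρ y‖ ^ 2 := by gcongr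
        simp only [hxy, if_false, shiftedAdj_of_not_adj _ hxy ha]
        push_cast at h3
        nlinarith
  have hsum := (Finset.sum_le_sum fun x _ => Finset.sum_le_sum fun y _ => hterm x y).trans hQ
  simp only [Finset.sum_sub_distrib, ← Finset.mul_sum, h.regular.sum_shiftedAdj] at hsum
  simp [hcard] at hsum
  have hfin : 4 * c * (ν - 1) - (4 * c + (1 - c) * D ^ 2) * k ≤ 0 := by
    refine nonpos_of_mul_nonpos_right ?_ hν0
    linarith
  rw [Real.sqrt_le_left hD0, div_le_iff₀ (mul_pos hk (by linarith))]
  have h6 := mul_nonpos_of_nonpos_of_nonneg hfin hν0.le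
  have h7 : (4 * c * (ν - 1) - (4 * c + (1 - c) * D ^ 2) * k) * ν =
      4 * (ν - k - 1) * (k - r) - D ^ 2 * (k * (ν - k + r)) := by
    linear_combination (4 * ((ν : ℝ) - 1) - 4 * k + D ^ 2 * k) * hc
  linarith

theorem mem_distortionSet (h : G.IsSRGWith ν k l μ) (hG : G.ediam = 2) {r : ℝ}
    (hr : r = (1 / 2 : ℝ) * ((l : ℝ) - μ + √(((l : ℝ) - μ) ^ 2 + 4 * ((k : ℝ) - μ)))) :
    √((4 * ((ν : ℝ) - k - 1) * (k - r)) / (k * (ν - k + r))) ∈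
      distortionSet (pathMetric G) := by
  obtain ⟨s, hadd, hmul, hr0, hs, hrk, hprod, hμ, hk, hν, hparam⟩ := h.param_relations hG hr
  have hden : 0 < (k : ℝ) * (ν - k + r) := mul_pos hk (by linarith)
  -- In terms of s, the target D² is the squared edge length of the embedding below.
  have hval : (4 * ((ν : ℝ) - k - 1) * (k - r)) / (k * (ν - k + r)) = 4 * (s + 1) / s := by
    rw [div_eq_div_iff hden.ne' hs.ne]
    refine mul_right_cancel₀ hμ.ne' ?_
    have hμ' : (μ : ℝ) = k + r * s := by linarith
    have hl' : (l : ℝ) = k + r * s + r + s := by linarith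
    rw [hl'] at hparam
    rw [hμ'] at hparam hprod ⊢
    linear_combination (-4 * (k - r) * s) * hparam + 4 * (s + 1) * k * hprod
  rw [hval]
  have hD0 : 0 ≤ 4 * (s + 1) / s := by
    rw [← hval]
    exact div_nonneg (mul_nonneg (mul_nonneg zero_le_four hν.le) (by linarith)) hden.le
  have hrs : 0 < r - s := by linarith
  -- The scale t gives nonadjacent vertices squared distance 4.
  let t : ℝ := √(-2 / (s * (r - s)))
  have ht : t ^ 2 = -2 / (s * (r - s)) :=
    Real.sq_sqrt (div_nonneg_of_nonpos (by norm_num) (mul_nonpos_of_nonpos_of_nonneg hs.le hrs.le))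
  have hf : ∀ x y, ∑ z, (t * G.shiftedAdj s x z - t * G.shiftedAdj s y z) ^ 2 =
      4 * (s + G.shiftedAdj s x y) / s := fun x y => by
    simp only [← mul_sub, mul_pow, ← Finset.mul_sum]
    rw [h.sum_sq_shiftedAdj_sub (by linarith : s + r = l - μ) (by linarith : s * r = μ - k), ht]
    field_simp
    ring
  -- For x, y nonadjacent with common neighbour z, ‖u + v‖² ≤ 2‖u‖² + 2‖v‖² gives 4 ≤ 4D².
  have hD1 : 1 ≤ 4 * (s + 1) / s := by
    obtain ⟨x, y, hxy, hna⟩ := exists_not_adj_of_ediam_eq_two hG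
    obtain ⟨z, hxz, hzy⟩ := exists_common_neighbor_of_ediam_eq_two hG hxy hna
    have h1 := hf x y
    rw [shiftedAdj_of_not_adj s hxy hna, add_zero, mul_div_cancel_right₀ _ hs.ne] at h1
    have h2 := hf x z
    have h3 := hf z y
    rw [shiftedAdj_of_adj s hxz] at h2
    rw [shiftedAdj_of_adj s hzy] at h3
    have h4 : ∑ w, (t * G.shiftedAdj s x w - t * G.shiftedAdj s y w) ^ 2 ≤
        ∑ w, (2 * (t * G.shiftedAdj s x w - t * G.shiftedAdj s z w) ^ 2 +
          2 * (t * G.shiftedAdj s z w - t * G.shiftedAdj s y w) ^ 2) := by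
      refine Finset.sum_le_sum fun w _ => ?_
      nlinarith [sq_nonneg ((t * G.shiftedAdj s x w - t * G.shiftedAdj s z w) -
        (t * G.shiftedAdj s z w - t * G.shiftedAdj s y w))]
    rw [Finset.sum_add_distrib, ← Finset.mul_sum, ← Finset.mul_sum, h1, h2, h3] at h4
    linarith
  refine mem_distortionSet_of_sq (fun x y => by rw [pathMetric]; positivity) (Real.sqrt_nonneg _)
    (fun x z => t * G.shiftedAdj s x z) fun x y => ?_
  rw [hf, Real.sq_sqrt hD0, pathMetric]
  by_cases hxy : x = y
  · subst hxy
    simp [shiftedAdj_self]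
  · by_cases ha : G.Adj x y
    · rw [shiftedAdj_of_adj s ha, dist_eq_one_iff_adj.2 ha]
      simpa using hD1
    · rw [shiftedAdj_of_not_adj s hxy ha, dist_eq_two hG hxy ha, add_zero,
        mul_div_cancel_right₀ _ hs.ne]
      push_cast
      constructor
      · norm_num
      · linarith

end SimpleGraph.IsSRGWith

theorem theorem2 :
    -- (a) Hamming graphs
    (∀ (X : Type*) [Fintype X] [DecidableEq X] (q n : ℕ), Fintype.card X = q → 2 ≤ q →
      IsLeastDistortion (hammingGraph X n) (√(n : ℝ))) ∧
    -- (b) Johnson graphs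
    (∀ (V : Type*) [Fintype V] [DecidableEq V] (v n : ℕ), Fintype.card V = v → 2 * n ≤ v →
      IsLeastDistortion (johnsonGraph V n) (√(n : ℝ))) ∧
    -- (c) strongly regular graphs of diameter 2
    (∀ (V : Type*) [Fintype V] [DecidableEq V] (G : SimpleGraph V) [DecidableRel G.Adj]
      (ν k l μ : ℕ) (r : ℝ), G.IsSRGWith ν k l μ → G.ediam = 2 →
      r = (1 / 2 : ℝ) * ((l : ℝ) - μ + √(((l : ℝ) - μ) ^ 2 + 4 * ((k : ℝ) - μ))) →
      IsGreatest {θ : ℝ | θ ≠ k ∧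
        Module.End.HasEigenvalue (Matrix.toLin' (G.adjMatrix ℝ)) θ} r ∧
      IsLeastDistortion G (√((4 * ((ν : ℝ) - k - 1) * (k - r)) / (k * (ν - k + r))))) :=
  ⟨fun X _ _ _ n hX hq => isLeastDistortion_hammingGraph X n (hX ▸ hq),
    fun V _ _ _ n hV hn => isLeastDistortion_johnsonGraph V n (hV ▸ hn),
    fun _ _ _ _ _ _ _ _ _ _ h hG hr => ⟨h.isGreatest_eigenvalue hG hr,
      h.mem_distortionSet hG hr, fun _ hD => h.le_of_mem_distortionSet hG hr hD⟩⟩
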